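/- Let $0<q<1$, and write $(x;q)_n=\prod_{k=0}^{n-1}(1-xq^k)$, $(x_1,\dots,x_r;q)_n=(x_1;q)_n\cdots(x_r;q)_n$, and $${}_r\phi_s\!\left({a_1,\dots,a_r\atop b_1,\dots,b_s};q,z\right)=\sum_{n=0}^\infty\frac{(a_1,\dots,a_r;q)_n}{(q,b_1,\dots,b_s;q)_n}\left((-1)^nq^{n(n-1)/2}\right)^{1+s-r}z^n ,$$ a series with upper parameter $q^{-m}$ being understood to terminate at $n=m$. Then for every nonnegative integer $m$ and all complex numbers $\alpha,a,b$ for which no denominator below vanishes (that is, $\alpha,a,b\neq0$, $\alpha\ne1$, and each of $(\alpha a,\alpha b;q)_m$, $(\sqrt{q\alpha},-\sqrt{q\alpha},q^2/(\alpha abq^m);q)_m$ and $(\alpha q^{m+1};q)_{2\lfloor m/2\rfloor}$ is nonzero), and for either choice of the square root $\sqrt{q\alpha}$, $$\frac{(\alpha q,\alpha ab/q;q)_m}{(\alpha a,\alpha b;q)_m}\;{}_4\phi_3\!\left({q^{-m},\,q/a,\,q/b,\,0\atop \sqrt{q\alpha},\,-\sqrt{q\alpha},\,q^2/(\alpha abq^m)};q,q\right)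 =\sum_{n=0}^{\lfloor m/2\rfloor}\frac{(1-\alpha q^{4n})\,(q^{-m},\alpha,q/a,q/b;q)_{2n}\,(q;q^2)_n\,(-\alpha^3a^2b^2q^{2m-2})^n\,q^{n^2}}{(1-\alpha)\,(q,\alpha q^{m+1},\alpha a,\alpha b;q)_{2n}\,(q\alpha;q^2)_n}.$$ -/

import Mathlib

/-- The finite `q`-shifted factorial `(a; q)_n = ∏_{k=0}^{n-1} (1 - a q^k)`. -/
noncomputable def qPoch (a q : ℂ) (n : ℕ) : ℂ :=
  ∏ k ∈ Finset.range n, (1 - a * q ^ k)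

/-- The compact notation `(a₁, a₂, …, a_r; q)_n = (a₁; q)_n (a₂; q)_n ⋯ (a_r; q)_n`. -/
noncomputable def qPochs (as : List ℂ) (q : ℂ) (n : ℕ) : ℂ :=
  (as.map fun a => qPoch a q n).prod

/-- The basic hypergeometric series `_rφ_s` with upper parameters `as` (so `r = as.length`) and
lower parameters `bs` (so `s = bs.length`):
`∑_{n ≥ 0} (a₁, …, a_r; q)_n / (q, b₁, …, b_s; q)_n * ((-1)^n q^{n(n-1)/2})^{1+s-r} * z^n`.
When some upper parameter is `q^{-m}`, all terms with `n > m` are zero and the sum is finite. -/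
noncomputable def basicHypergeometric (as bs : List ℂ) (q z : ℂ) : ℂ :=
  ∑' n : ℕ, qPochs as q n / qPochs (q :: bs) q n *
    ((-1) ^ n * q ^ (n * (n - 1) / 2)) ^ (1 + (bs.length : ℤ) - (as.length : ℤ)) * z ^ n

open Filter Topology

/-! This is Bailey's lemma applied to a Bailey pair supported on even indices: `baileyCoeff`
supplies α_{2r}, and β_n = 1/((q;q)_n (qα;q²)_n) (`bailey_pair`). Put x = q/a, y = q/b, E = αab/q,
so Exy = αq. In `bailey_sum` each β_n is expanded and the sums are exchanged; the inner sum is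
q-Saalschütz (`saalschutz_convolution`). This needs αq^k ≠ 1 for all k; `bailey_transform` removes
that restriction by continuity in α. Reversing shifted factorials (`qPoch_reverse_ratio`) turns the
convolution into the ₄φ₃. -/

/-! ### Shifted factorials. -/

@[simp] lemma qPoch_zero (a q : ℂ) : qPoch a q 0 = 1 := by simp [qPoch]

lemma qPoch_succ (a q : ℂ) (n : ℕ) : qPoch a q (n + 1) = qPoch a q n * (1 - a * q ^ n) := by
  simp [qPoch, Finset.prod_range_succ]

@[simp] lemma qPoch_zero_left (q : ℂ) (n : ℕ) : qPoch 0 q n = 1 := by simp [qPoch]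

lemma qPoch_add (a q : ℂ) (m n : ℕ) :
    qPoch a q (m + n) = qPoch a q m * qPoch (a * q ^ m) q n := by
  simp only [qPoch, Finset.prod_range_add, pow_add, mul_assoc]

lemma qPoch_ne_zero_of_le {a q : ℂ} {m n : ℕ} (h : n ≤ m) (hm : qPoch a q m ≠ 0) :
    qPoch a q n ≠ 0 := by
  obtain ⟨k, rfl⟩ := Nat.exists_eq_add_of_le h
  rw [qPoch_add] at hm
  exact left_ne_zero_of_mul hm

lemma qPoch_ne_zero {a q : ℂ} (h : ∀ k : ℕ, a * q ^ k ≠ 1) (n : ℕ) : qPoch a q n ≠ 0 :=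
  Finset.prod_ne_zero_iff.2 fun k _ => sub_ne_zero.2 (h k).symm

/-- Splitting a shifted factorial of even length into its even and odd factors. -/
lemma qPoch_two_mul (a q : ℂ) (n : ℕ) :
    qPoch a q (2 * n) = qPoch a (q ^ 2) n * qPoch (a * q) (q ^ 2) n := by
  induction n with
  | zero => simp
  | succ n ih =>
    rw [show 2 * (n + 1) = 2 * n + 1 + 1 by ring, qPoch_succ, qPoch_succ, ih, qPoch_succ,
      qPoch_succ]
    ring

lemma qPoch_mul_qPoch_neg (s q : ℂ) (n : ℕ) :
    qPoch s q n * qPoch (-s) q n = qPoch (s ^ 2) (q ^ 2) n := by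
  simp only [qPoch, ← Finset.prod_mul_distrib]
  exact Finset.prod_congr rfl fun k _ => by ring

/-- Reversal of the order of the factors. -/
lemma qPoch_reverse {q c : ℂ} (hq : q ≠ 0) (hc : c ≠ 0) {n M : ℕ} (h : n ≤ M) :
    qPoch (q / (c * q ^ M)) q n =
      (-1 / c) ^ n * (∏ i ∈ Finset.range n, q ^ (i + 1) / q ^ M) * qPoch (c * q ^ (M - n)) q n := by
  have hconst : (-1 / c) ^ n = ∏ _i ∈ Finset.range n, (-1 / c) := by
    rw [Finset.prod_const, Finset.card_range]
  unfold qPoch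
  rw [hconst, ← Finset.prod_range_reflect (fun k => 1 - c * q ^ (M - n) * q ^ k),
    ← Finset.prod_mul_distrib, ← Finset.prod_mul_distrib]
  refine Finset.prod_congr rfl fun i hi => ?_
  have hi := Finset.mem_range.1 hi
  obtain ⟨j, rfl⟩ := Nat.exists_eq_add_of_le h
  obtain ⟨l, rfl⟩ := Nat.exists_eq_add_of_lt hi
  rw [show i + l + 1 + j - (i + l + 1) = j by omega, show i + l + 1 - 1 - i = l by omega]
  field_simp
  ring

lemma prod_range_pow_div (q : ℂ) (hq : q ≠ 0) (M r : ℕ) :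
    (∏ i ∈ Finset.range (2 * r), q ^ (i + 1) / q ^ M) = q ^ (2 * r ^ 2 + r) / q ^ (2 * M * r) := by
  induction r with
  | zero => simp
  | succ r ih =>
    rw [show 2 * (r + 1) = 2 * r + 1 + 1 by ring, Finset.prod_range_succ, Finset.prod_range_succ,
      ih]
    field_simp
    ring

/-! ### The q-Saalschütz sum. -/

/-- The `q`-Pfaff–Saalschütz summation, written as a convolution (the coefficient form of
Heine's `q`-analogue of Euler's transformation). -/
lemma saalschutz_convolution {q A B C E : ℂ} (hCE : C = E * A * B) (hq : ∀ n, qPoch q q n ≠ 0)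
    (hC : ∀ n, qPoch C q n ≠ 0) (M : ℕ) :
    ∑ k ∈ Finset.range (M + 1), qPoch A q k * qPoch B q k * E ^ k /
        (qPoch q q k * qPoch C q k) * (qPoch E q (M - k) / qPoch q q (M - k)) =
      qPoch (E * A) q M * qPoch (E * B) q M / (qPoch q q M * qPoch C q M) := by
  have hq1 : ∀ n, 1 - q * q ^ n ≠ 0 := fun n => by
    have := hq (n + 1); rw [qPoch_succ] at this; exact right_ne_zero_of_mul this
  have hC1 : ∀ n, 1 - C * q ^ n ≠ 0 := fun n => by
    have := hC (n + 1); rw [qPoch_succ] at this; exact right_ne_zero_of_mul this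
  set f : ℕ → ℂ := fun k => qPoch A q k * qPoch B q k * E ^ k /
        (qPoch q q k * qPoch C q k) with hf
  set g : ℕ → ℂ := fun k => qPoch E q k / qPoch q q k with hg
  have hfs : ∀ k, f (k + 1) * ((1 - q * q ^ k) * (1 - C * q ^ k)) =
      f k * (1 - A * q ^ k) * (1 - B * q ^ k) * E := fun k => by
    have := hq k; have := hC k; have h1 := hq1 k; have h2 := hC1 k
    simp only [hf, qPoch_succ, pow_succ]
    generalize 1 - q * q ^ k = u at *
    generalize 1 - C * q ^ k = v at *
    field_simp
  have hgs : ∀ k, g (k + 1) * (1 - q * q ^ k) = g k * (1 - E * q ^ k) := fun k => by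
    have := hq k; have h1 := hq1 k
    simp only [hg, qPoch_succ]
    generalize 1 - q * q ^ k = u at *
    field_simp
  change ∑ k ∈ Finset.range (M + 1), f k * g (M - k) = _
  induction M with
  | zero => simp [hf, hg]
  | succ M ih =>
    -- Creative telescoping: the recurrence in `M` is summed with an explicit certificate. It
    -- vanishes at `n = 0`; at `n = M + 1` it cancels the one extra term of the longer sum.
    have key : ∀ n ≤ M + 1, (1 - q * q ^ M) * (1 - C * q ^ M) *
          ∑ k ∈ Finset.range n, f k * g (M + 1 - k) -
        (1 - E * A * q ^ M) * (1 - E * B * q ^ M) * ∑ k ∈ Finset.range n, f k * g (M - k) =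
        - ((q ^ (M + 1 - n) - C * q ^ M) * (1 - q ^ n) * f n * g (M + 1 - n)) := by
      intro n
      induction n with
      | zero => simp
      | succ k ihk =>
        intro hk
        have ihk := ihk (by omega)
        rw [Finset.sum_range_succ, Finset.sum_range_succ, mul_add, mul_add]
        obtain ⟨j, rfl⟩ := Nat.exists_eq_add_of_le (show k ≤ M by omega)
        rw [show k + j + 1 - (k + 1) = j by omega]
        rw [show k + j + 1 - k = j + 1 by omega] at ihk ⊢
        rw [show k + j - k = j by omega]
        have h1 := hfs k
        have h2 := hgs j
        refine mul_left_cancel₀ (hq1 j) ?_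
        clear_value f g
        subst hCE
        linear_combination (1 - q * q ^ j) * ihk +
          ((1 - q * q ^ (k + j)) * (1 - E * A * B * q ^ (k + j)) * f k -
            (q ^ (j + 1) - E * A * B * q ^ (k + j)) * (1 - q ^ k) * f k) * h2 +
          q ^ j * (1 - q * q ^ j) * g j * h1
    have hkey := key (M + 1) le_rfl
    rw [ih] at hkey
    rw [Finset.sum_range_succ]
    have h1 := hq M; have h2 := hC M; have h3 := hq1 M; have h4 := hC1 M
    refine mul_left_cancel₀ (mul_ne_zero h3 h4) ?_
    have h5 : (1 - q * q ^ M) * (1 - C * q ^ M) * (qPoch (E * A) q (M + 1) *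
        qPoch (E * B) q (M + 1) / (qPoch q q (M + 1) * qPoch C q (M + 1))) =
        (1 - E * A * q ^ M) * (1 - E * B * q ^ M) *
          (qPoch (E * A) q M * qPoch (E * B) q M / (qPoch q q M * qPoch C q M)) := by
      simp only [qPoch_succ]
      generalize 1 - q * q ^ M = u at *
      generalize 1 - C * q ^ M = v at *
      field_simp
    rw [h5]
    simp only [Nat.sub_self, pow_zero] at hkey ⊢
    linear_combination hkey

/-! ### The Bailey pair. -/

/-- The nonzero entries `α_{2r}` of the Bailey pair whose `β_n` is `1 / ((q;q)_n (qα;q²)_n)`. -/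
noncomputable def baileyCoeff (α q : ℂ) (r : ℕ) : ℂ :=
  (1 - α * q ^ (4 * r)) / (1 - α) * (qPoch α (q ^ 2) r / qPoch (q ^ 2) (q ^ 2) r) *
    ((-α) ^ r * q ^ (3 * r ^ 2 - r))

lemma bailey_pair {q α : ℂ} (hq : ∀ n, qPoch q q n ≠ 0) (hα : ∀ k : ℕ, α * q ^ k ≠ 1) (N : ℕ) :
    ∑ r ∈ Finset.range (N / 2 + 1),
        baileyCoeff α q r / (qPoch q q (N - 2 * r) * qPoch (α * q) q (N + 2 * r)) =
      1 / (qPoch q q N * qPoch (q * α) (q ^ 2) N) := by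
  have hq1 : ∀ n, 1 - q * q ^ n ≠ 0 := fun n => by
    have := hq (n + 1); rw [qPoch_succ] at this; exact right_ne_zero_of_mul this
  have hα1 : ∀ n, 1 - α * q ^ n ≠ 0 := fun n => sub_ne_zero.2 (hα n).symm
  have hqα : ∀ n, qPoch (q * α) (q ^ 2) n ≠ 0 :=
    qPoch_ne_zero fun k => by rw [← pow_mul, mul_comm q, mul_assoc, ← pow_succ']; exact hα _
  -- `d` is `baileyCoeff` without its very-well-poised factor
  set d : ℕ → ℂ := fun r => qPoch α (q ^ 2) r / qPoch (q ^ 2) (q ^ 2) r *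
    ((-α) ^ r * q ^ (3 * r ^ 2 - r)) / (1 - α) with hd
  have hq2 : ∀ n, qPoch (q ^ 2) (q ^ 2) n ≠ 0 := fun n => by
    have := hq (2 * n)
    rw [qPoch_two_mul, ← pow_two] at this
    exact right_ne_zero_of_mul this
  have hds : ∀ r, d (r + 1) * (1 - q ^ 2 * (q ^ 2) ^ r) =
      - d r * α * (1 - α * (q ^ 2) ^ r) * q ^ (6 * r + 2) := fun r => by
    have h1 := hq2 r
    have h2 : 1 - q ^ 2 * (q ^ 2) ^ r ≠ 0 := by
      have := hq2 (r + 1); rw [qPoch_succ] at this; exact right_ne_zero_of_mul this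
    have h3 : 3 * (r + 1) ^ 2 - (r + 1) = (3 * r ^ 2 - r) + (6 * r + 2) := by
      have : r ≤ 3 * r ^ 2 := by nlinarith
      have : 3 * (r + 1) ^ 2 = 3 * r ^ 2 + 6 * r + 3 := by ring
      omega
    have h4 := hα1 0
    simp only [hd, qPoch_succ, h3, pow_succ (-α) r, pow_add q (3 * r ^ 2 - r)]
    rw [pow_zero, mul_one] at h4
    generalize 1 - q ^ 2 * (q ^ 2) ^ r = u at *
    generalize 1 - α = v at *
    field_simp
  have hc : ∀ r, baileyCoeff α q r = (1 - α * q ^ (4 * r)) * d r := fun r => by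
    simp only [hd, baileyCoeff]; ring
  set u : ℕ → ℂ := fun n => (qPoch q q n)⁻¹ with hu
  set v : ℕ → ℂ := fun n => (qPoch (α * q) q n)⁻¹ with hv
  have hus : ∀ n, u n = u (n + 1) * (1 - q * q ^ n) := fun n => by
    have := hq1 n
    simp only [hu, qPoch_succ]
    generalize 1 - q * q ^ n = w at *
    field_simp
  have hvs : ∀ n, v n = v (n + 1) * (1 - α * q ^ (n + 1)) := fun n => by
    have := hα1 (n + 1)
    simp only [hv, qPoch_succ, mul_assoc, ← pow_succ']
    generalize 1 - α * q ^ (n + 1) = w at *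
    field_simp
  have hF : ∀ N r, baileyCoeff α q r / (qPoch q q (N - 2 * r) * qPoch (α * q) q (N + 2 * r)) =
      (1 - α * q ^ (4 * r)) * d r * u (N - 2 * r) * v (N + 2 * r) := fun N r => by
    rw [hc, div_eq_mul_inv, mul_inv]; ring
  simp only [hF]
  induction N with
  | zero =>
    have h := hα1 0
    rw [pow_zero, mul_one] at h
    simp [hd, hu, hv, h]
  | succ N ih =>
    -- Again creative telescoping, for the recurrence (1 - q^{N+1})(1 - αq^{2N+1}) S_{N+1} = S_N.
    -- The last bracket is morally `v (N + 2 * n - 1)`, written so as to avoid truncated subtraction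
    -- at `N = n = 0`.
    have key : ∀ n, 2 * n ≤ N + 1 → (1 - q * q ^ N) * (1 - α * q ^ (2 * N + 1)) *
          ∑ r ∈ Finset.range n,
            (1 - α * q ^ (4 * r)) * d r * u (N + 1 - 2 * r) * v (N + 1 + 2 * r) -
          ∑ r ∈ Finset.range n, (1 - α * q ^ (4 * r)) * d r * u (N - 2 * r) * v (N + 2 * r) =
        -(q ^ (N + 1 - 2 * n) * (1 - q ^ (2 * n)) * d n * u (N + 1 - 2 * n) *
          ((1 - α * q ^ (N + 2 * n)) * (1 - α * q ^ (N + 1 + 2 * n)) * v (N + 1 + 2 * n))) := by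
      intro n
      induction n with
      | zero => simp
      | succ n ihn =>
        intro hn
        have ihn := ihn (by omega)
        obtain ⟨j, rfl⟩ := Nat.exists_eq_add_of_le (show 2 * n + 1 ≤ N by omega)
        rw [Finset.sum_range_succ, Finset.sum_range_succ]
        rw [show 2 * n + 1 + j + 1 - 2 * (n + 1) = j by omega,
          show 2 * n + 1 + j + 1 + 2 * (n + 1) = 4 * n + j + 2 + 1 + 1 by ring,
          show 2 * n + 1 + j - 2 * n = j + 1 by omega,
          show 2 * n + 1 + j + 2 * n = 4 * n + j + 1 by ring]
        rw [show 2 * n + 1 + j + 1 - 2 * n = j + 1 + 1 by omega,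
          show 2 * n + 1 + j + 1 + 2 * n = 4 * n + j + 1 + 1 by ring,
          show 2 * n + 1 + j + 2 * n = 4 * n + j + 1 by ring] at *
        have e1 := hvs (4 * n + j + 1)
        have e2 : v (4 * n + j + 2) = (1 - α * q ^ (2 * n + 1 + j + 2 * (n + 1))) *
            (1 - α * q ^ (4 * n + j + 2 + 1 + 1)) * v (4 * n + j + 2 + 1 + 1) := by
          rw [hvs (4 * n + j + 2), hvs (4 * n + j + 2 + 1)]
          ring
        rw [← e2, e1, hus j, hus (j + 1)]
        have h1 := hds n
        clear_value d u v
        linear_combination ihn + q ^ j * u (j + 1 + 1) * (1 - q * q ^ (j + 1)) * (1 - q * q ^ j) *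
          v (4 * n + j + 2) * h1
    have hp : (1 - q * q ^ N) * (1 - α * q ^ (2 * N + 1)) ≠ 0 := mul_ne_zero (hq1 N) (hα1 _)
    have hR : 1 / (qPoch q q N * qPoch (q * α) (q ^ 2) N) =
        (1 - q * q ^ N) * (1 - α * q ^ (2 * N + 1)) *
          (1 / (qPoch q q (N + 1) * qPoch (q * α) (q ^ 2) (N + 1))) := by
      rw [qPoch_succ, qPoch_succ,
        show 1 - q * α * (q ^ 2) ^ N = 1 - α * q ^ (2 * N + 1) by ring]
      have h1 := hq1 N; have h2 := hα1 (2 * N + 1); have := hq N; have := hqα N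
      generalize 1 - q * q ^ N = w at *
      generalize 1 - α * q ^ (2 * N + 1) = z at *
      field_simp
    rw [hR] at ih
    refine mul_left_cancel₀ hp (Eq.trans ?_ ih)
    -- For even `N` both sums have the same range and their last terms remain to be matched; for odd
    -- `N` the longer sum gains one term, which the certificate cancels.
    rcases Nat.even_or_odd' N with ⟨n, rfl | rfl⟩
    · have h := key n (by omega)
      rw [show (2 * n + 1) / 2 = n by omega, show 2 * n / 2 = n by omega, Finset.sum_range_succ,
        Finset.sum_range_succ]
      rw [show 2 * n + 1 - 2 * n = 0 + 1 by omega, show 2 * n + 1 + 2 * n = 4 * n + 1 by ring,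
        show 2 * n + 2 * n = 4 * n by ring] at *
      rw [show 2 * n - 2 * n = 0 by omega, hvs (4 * n), hus 0]
      clear_value d u v
      linear_combination h
    · have h := key (n + 1) (by omega)
      rw [show (2 * n + 1 + 1) / 2 = n + 1 by omega, show (2 * n + 1) / 2 = n by omega,
        Finset.sum_range_succ]
      rw [show 2 * n + 1 + 1 - 2 * (n + 1) = 0 by omega] at *
      clear_value d u v
      linear_combination h

/-! ### Bailey's lemma and its extension in α. -/

lemma bailey_sum {q α x y E : ℂ} (hq : ∀ n, qPoch q q n ≠ 0) (hα : ∀ k : ℕ, α * q ^ k ≠ 1)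
    (hE : E * x * y = α * q) (m : ℕ) :
    ∑ n ∈ Finset.range (m + 1), qPoch x q n * qPoch y q n * E ^ n *
        (qPoch E q (m - n) / qPoch q q (m - n)) *
        (1 / (qPoch q q n * qPoch (q * α) (q ^ 2) n)) =
      ∑ r ∈ Finset.range (m / 2 + 1), baileyCoeff α q r * (qPoch x q (2 * r) * qPoch y q (2 * r) *
        E ^ (2 * r) * (qPoch (E * x * q ^ (2 * r)) q (m - 2 * r) *
        qPoch (E * y * q ^ (2 * r)) q (m - 2 * r))) /
        (qPoch q q (m - 2 * r) * qPoch (α * q) q (m + 2 * r)) := by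
  have hαp : ∀ j n, qPoch (α * q * q ^ j) q n ≠ 0 := fun j =>
    qPoch_ne_zero fun k => by rw [mul_assoc, mul_assoc, ← pow_add, ← pow_succ']; exact hα _
  simp only [← bailey_pair hq hα, Finset.mul_sum]
  -- The region is 2r ≤ n ≤ m. Shifting n by 2r makes the inner sum Saalschützian, since Exy = αq
  -- gives C = EAB.
  rw [Finset.sum_comm' (t' := Finset.range (m / 2 + 1))
    (s' := fun r => Finset.Ico (2 * r) (m + 1))
    (fun n r => by simp only [Finset.mem_range, Finset.mem_Ico]; omega)]
  refine Finset.sum_congr rfl fun r hr => ?_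
  have hr := Finset.mem_range.1 hr
  obtain ⟨M, rfl⟩ := Nat.exists_eq_add_of_le (show 2 * r ≤ m by omega)
  rw [Finset.sum_Ico_eq_sum_range, show 2 * r + M + 1 - 2 * r = M + 1 by omega,
    show 2 * r + M - 2 * r = M by omega, show 2 * r + M + 2 * r = 4 * r + M by ring,
    qPoch_add (α * q) q (4 * r)]
  have hS := saalschutz_convolution (q := q) (A := x * q ^ (2 * r)) (B := y * q ^ (2 * r))
    (C := α * q * q ^ (4 * r)) (E := E) (by rw [← hE]; ring) hq (hαp _) M
  simp only [← mul_assoc] at hS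
  refine Eq.trans ?_ ((congrArg (fun z => baileyCoeff α q r * (qPoch x q (2 * r) *
    qPoch y q (2 * r) * E ^ (2 * r)) / qPoch (α * q) q (4 * r) * z) hS).trans ?_)
  swap
  · simp only [div_eq_mul_inv, mul_inv]
    ring
  rw [Finset.mul_sum]
  refine Finset.sum_congr rfl fun k _ => ?_
  rw [show 2 * r + M - (2 * r + k) = M - k by omega, show 2 * r + k - 2 * r = k by omega,
    show 2 * r + k + 2 * r = 4 * r + k by ring, qPoch_add (α * q) q (4 * r), qPoch_add x,
    qPoch_add y, pow_add E]
  simp only [div_eq_mul_inv, mul_inv]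
  ring

@[fun_prop]
lemma continuousAt_qPoch {f : ℂ → ℂ} {x : ℂ} (hf : ContinuousAt f x) (q : ℂ) (n : ℕ) :
    ContinuousAt (fun t => qPoch (f t) q n) x := by
  unfold qPoch
  fun_prop

lemma dense_forall_mul_pow_ne_one (q : ℂ) : Dense {α : ℂ | ∀ k : ℕ, α * q ^ k ≠ 1} := by
  have hc : (Set.range fun k : ℕ => (q ^ k)⁻¹).Countable := Set.countable_range _
  refine (hc.dense_compl ℝ).mono ?_
  intro α hα k hk
  exact hα ⟨k, (eq_inv_of_mul_eq_one_left hk).symm⟩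

/-- The transformation with all denominators that can vanish removed. -/
lemma bailey_transform {q α x y e : ℂ} (hq : ∀ n, qPoch q q n ≠ 0) (he : e * x * y = q) (m : ℕ)
    (hα1 : α ≠ 1) (hqα : qPoch (q * α) (q ^ 2) m ≠ 0)
    (hαm : qPoch (α * q ^ (m + 1)) q (2 * (m / 2)) ≠ 0) :
    qPoch (α * q) q m * ∑ n ∈ Finset.range (m + 1), qPoch x q n * qPoch y q n * (α * e) ^ n *
        (qPoch (α * e) q (m - n) / qPoch q q (m - n)) *
        (1 / (qPoch q q n * qPoch (q * α) (q ^ 2) n)) =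
      ∑ r ∈ Finset.range (m / 2 + 1), baileyCoeff α q r * (qPoch x q (2 * r) * qPoch y q (2 * r) *
        (α * e) ^ (2 * r) * (qPoch (α * e * x * q ^ (2 * r)) q (m - 2 * r) *
        qPoch (α * e * y * q ^ (2 * r)) q (m - 2 * r))) /
        (qPoch q q (m - 2 * r) * qPoch (α * q ^ (m + 1)) q (2 * r)) := by
  have hS := dense_forall_mul_pow_ne_one q
  have : (𝓝[{α : ℂ | ∀ k : ℕ, α * q ^ k ≠ 1}] α).NeBot :=
    mem_closure_iff_nhdsWithin_neBot.1 (hS α)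
  -- Both sides are continuous at α and agree on a dense set. Keeping `e` fixed, with E = αe, makes
  -- the constraint `he` independent of α.
  refine tendsto_nhds_unique_of_eventuallyEq (l := 𝓝[{α : ℂ | ∀ k : ℕ, α * q ^ k ≠ 1}] α)
    (f := fun α => qPoch (α * q) q m * ∑ n ∈ Finset.range (m + 1), qPoch x q n * qPoch y q n *
        (α * e) ^ n * (qPoch (α * e) q (m - n) / qPoch q q (m - n)) *
        (1 / (qPoch q q n * qPoch (q * α) (q ^ 2) n)))
    (g := fun α => ∑ r ∈ Finset.range (m / 2 + 1), baileyCoeff α q r *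
        (qPoch x q (2 * r) * qPoch y q (2 * r) *
        (α * e) ^ (2 * r) * (qPoch (α * e * x * q ^ (2 * r)) q (m - 2 * r) *
        qPoch (α * e * y * q ^ (2 * r)) q (m - 2 * r))) /
        (qPoch q q (m - 2 * r) * qPoch (α * q ^ (m + 1)) q (2 * r)))
    (Tendsto.mono_left (ContinuousAt.tendsto ?_) nhdsWithin_le_nhds)
    (Tendsto.mono_left (ContinuousAt.tendsto ?_) nhdsWithin_le_nhds) ?_
  · refine ContinuousAt.mul (by fun_prop) (tendsto_finsetSum _ fun n hn => ?_)
    have h1 : qPoch q q n * qPoch (q * α) (q ^ 2) n ≠ 0 := mul_ne_zero (hq n)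
      (qPoch_ne_zero_of_le (Nat.lt_succ_iff.1 (Finset.mem_range.1 hn)) hqα)
    refine ContinuousAt.mul (by fun_prop) (ContinuousAt.div (by fun_prop) (by fun_prop) h1)
  · refine tendsto_finsetSum _ fun r hr => ?_
    have hr := Finset.mem_range.1 hr
    have h1 : qPoch q q (m - 2 * r) * qPoch (α * q ^ (m + 1)) q (2 * r) ≠ 0 :=
      mul_ne_zero (hq _) (qPoch_ne_zero_of_le (by omega) hαm)
    have h2 : 1 - α ≠ 0 := sub_ne_zero.2 hα1.symm
    refine ContinuousAt.div (ContinuousAt.mul ?_ (by fun_prop)) (by fun_prop) h1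
    unfold baileyCoeff
    refine ContinuousAt.mul (ContinuousAt.mul
      (ContinuousAt.div (by fun_prop) (by fun_prop) h2) (by fun_prop)) (by fun_prop)
  · filter_upwards [self_mem_nhdsWithin] with α hα
    rw [bailey_sum hq hα (by rw [← he]; ring) m, Finset.mul_sum]
    refine Finset.sum_congr rfl fun r _ => ?_
    have h0 : qPoch (α * q) q m ≠ 0 :=
      qPoch_ne_zero (fun k => by rw [mul_assoc, ← pow_succ']; exact hα _) m
    rw [qPoch_add (α * q) q m, show α * q * q ^ m = α * q ^ (m + 1) by ring]
    field_simp

/-! ### From the convolution to the ₄φ₃. -/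

/-- `qPoch_reverse` is used with c = q and c = E; the product of powers of q does not depend on c
and cancels. -/
lemma qPoch_reverse_ratio {q E : ℂ} (hq0 : q ≠ 0) (hq : ∀ n, qPoch q q n ≠ 0) (hE : E ≠ 0)
    {n m : ℕ} (h : n ≤ m) (hEm : qPoch (q / (E * q ^ m)) q m ≠ 0) :
    qPoch (q / (q * q ^ m)) q n / qPoch (q / (E * q ^ m)) q n * q ^ n * qPoch E q m =
      E ^ n * (qPoch q q m / qPoch q q (m - n)) * qPoch E q (m - n) := by
  have hn := qPoch_ne_zero_of_le h hEm
  have h1 := qPoch_add q q (m - n) n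
  have h2 := qPoch_add E q (m - n) n
  rw [Nat.sub_add_cancel h] at h1 h2
  have h6 : (-1 / E) ^ n * E ^ n = (-1 / q) ^ n * q ^ n := by
    rw [← mul_pow, ← mul_pow, div_mul_cancel₀ _ hE, div_mul_cancel₀ _ hq0]
  rw [qPoch_reverse hq0 hE h] at hn ⊢
  rw [qPoch_reverse hq0 hq0 h, h1, h2]
  have h3 := hq (m - n)
  have h4 := right_ne_zero_of_mul hn
  have h5 := right_ne_zero_of_mul (left_ne_zero_of_mul hn)
  generalize (∏ i ∈ Finset.range n, q ^ (i + 1) / q ^ m) = w at *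
  have h7 := left_ne_zero_of_mul (left_ne_zero_of_mul hn)
  generalize (-1 / E) ^ n = u at *
  generalize (-1 / q) ^ n = v at *
  generalize qPoch (E * q ^ (m - n)) q n = z at *
  field_simp
  linear_combination -qPoch E q (m - n) * qPoch (q * q ^ (m - n)) q n * h6

/-- Here 1 + s - r = 0, so the quadratic power disappears, and the product over ±s depends only on
s². -/
lemma basicHypergeometric_eq_sum {q : ℂ} (hq0 : q ≠ 0) (m : ℕ) (x y s d : ℂ) :
    basicHypergeometric [q ^ (-(m : ℤ)), x, y, 0] [s, -s, d] q q =
      ∑ n ∈ Finset.range (m + 1), qPoch (q / (q * q ^ m)) q n / qPoch d q n * q ^ n *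
        (qPoch x q n * qPoch y q n / (qPoch q q n * qPoch (s ^ 2) (q ^ 2) n)) := by
  have hqm : q ^ (-(m : ℤ)) = q / (q * q ^ m) := by
    rw [zpow_neg, zpow_natCast]; field_simp
  unfold basicHypergeometric
  rw [tsum_eq_sum (s := Finset.range (m + 1))]
  · refine Finset.sum_congr rfl fun n _ => ?_
    rw [hqm, ← qPoch_mul_qPoch_neg]
    simp [qPochs, div_eq_mul_inv]
    ring
  · intro n hn
    have : qPoch (q ^ (-(m : ℤ))) q n = 0 := by
      refine Finset.prod_eq_zero (i := m) (by
        simp only [Finset.mem_range] at hn ⊢; omega) ?_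
      simp [hq0]
    simp only [qPochs, List.map_cons, this, List.prod_cons, zero_mul, zero_div]

/-- Matches the powers left by reversing (q^{-m};q)_{2r} with those in `baileyCoeff` and E^{2r}. -/
lemma power_factor_identity {q : ℂ} (hq0 : q ≠ 0) (α E : ℂ) (m r : ℕ) :
    (-1 / q) ^ (2 * r) * (q ^ (2 * r ^ 2 + r) / q ^ (2 * m * r)) *
        (-(α * E ^ 2 * (q ^ m) ^ 2)) ^ r * q ^ (r ^ 2) =
      (-α) ^ r * q ^ (3 * r ^ 2 - r) * E ^ (2 * r) := by
  have h : q ^ (2 * r ^ 2 + r) * q ^ (r ^ 2) = q ^ (3 * r ^ 2 - r) * q ^ (2 * r) := by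
    rw [← pow_add, ← pow_add]
    congr 1
    have : r ≤ 3 * r ^ 2 := by nlinarith
    omega
  have h1 : (-(α * E ^ 2 * (q ^ m) ^ 2)) ^ r = (-α) ^ r * E ^ (2 * r) * q ^ (2 * m * r) := by
    rw [show -(α * E ^ 2 * (q ^ m) ^ 2) = -α * E ^ 2 * (q ^ m) ^ 2 by ring, mul_pow, mul_pow]
    simp only [← pow_mul]
    rw [show m * 2 * r = 2 * m * r by ring]
  have h2 : (-1 / q) ^ (2 * r) = 1 / q ^ (2 * r) := by
    rw [div_pow, pow_mul (-1), neg_one_sq, one_pow]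
  rw [h1, h2]
  have hA : q ^ (2 * r) ≠ 0 := pow_ne_zero _ hq0
  have hB : q ^ (2 * m * r) ≠ 0 := pow_ne_zero _ hq0
  generalize q ^ (2 * r) = u at *
  generalize q ^ (2 * m * r) = v at *
  generalize q ^ (2 * r ^ 2 + r) = c at *
  generalize q ^ (3 * r ^ 2 - r) = d at *
  generalize q ^ (r ^ 2) = z at *
  generalize (-α) ^ r = x at *
  generalize E ^ (2 * r) = y at *
  field_simp
  linear_combination x * y * h

theorem theorem10p5 (m : ℕ) (q : ℝ) (hq0 : 0 < q) (hq1 : q < 1)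
    (α a b s : ℂ)
    -- `s` is either one of the two square roots of `q α`
    (hs : s ^ 2 = (q : ℂ) * α)
    -- no zero factors in the denominators
    (hα0 : α ≠ 0) (ha0 : a ≠ 0) (hb0 : b ≠ 0) (hα1 : α ≠ 1)
    (hab : qPochs [α * a, α * b] q m ≠ 0)
    (hlow : qPochs [s, -s, (q : ℂ) ^ 2 / (α * a * b * (q : ℂ) ^ m)] q m ≠ 0)
    (hαm : qPoch (α * (q : ℂ) ^ (m + 1)) q (2 * (m / 2)) ≠ 0) :
    qPochs [α * q, α * a * b / q] q m / qPochs [α * a, α * b] q m *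
        basicHypergeometric
          [(q : ℂ) ^ (-(m : ℤ)), q / a, q / b, 0]
          [s, -s, (q : ℂ) ^ 2 / (α * a * b * (q : ℂ) ^ m)] q q =
      ∑ n ∈ Finset.range (m / 2 + 1),
        ((1 - α * (q : ℂ) ^ (4 * n)) *
            qPochs [(q : ℂ) ^ (-(m : ℤ)), α, q / a, q / b] q (2 * n) *
            qPoch q ((q : ℂ) ^ 2) n *
            (-(α ^ 3 * a ^ 2 * b ^ 2 * (q : ℂ) ^ (2 * (m : ℤ) - 2))) ^ n *
            (q : ℂ) ^ (n ^ 2)) /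
          ((1 - α) *
            qPochs [(q : ℂ), α * (q : ℂ) ^ (m + 1), α * a, α * b] q (2 * n) *
            qPoch (q * α) ((q : ℂ) ^ 2) n) := by
  have hQ0 : (q : ℂ) ≠ 0 := by exact_mod_cast hq0.ne'
  have hQ : ∀ n, qPoch (q : ℂ) q n ≠ 0 := qPoch_ne_zero fun k => by
    rw [← pow_succ']
    exact_mod_cast (pow_lt_one₀ hq0.le hq1 k.succ_ne_zero).ne
  -- From here on only q ≠ 0 and (q;q)_n ≠ 0 matter.
  generalize (q : ℂ) = q at *
  obtain ⟨e, he⟩ : ∃ e, e = a * b / q := ⟨_, rfl⟩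
  have hE0 : α * e ≠ 0 := by rw [he]; positivity
  have hE1 : α * a * b / q = α * e := by rw [he]; ring
  have hE2 : q ^ 2 / (α * a * b * q ^ m) = q / (α * e * q ^ m) := by rw [he]; field_simp
  have hexy : e * (q / a) * (q / b) = q := by rw [he]; field_simp
  have hEx : α * e * (q / a) = α * b := by rw [he]; field_simp
  have hEy : α * e * (q / b) = α * a := by rw [he]; field_simp
  have hqm : q ^ (-(m : ℤ)) = q / (q * q ^ m) := by
    rw [zpow_neg, zpow_natCast]; field_simp
  have hpow : α ^ 3 * a ^ 2 * b ^ 2 * q ^ (2 * (m : ℤ) - 2) = α * (α * e) ^ 2 * (q ^ m) ^ 2 := by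
    rw [he, zpow_sub₀ hQ0, zpow_mul, zpow_natCast]
    norm_cast
    rw [← pow_mul, mul_comm 2 m, pow_mul]
    field_simp
  rw [basicHypergeometric_eq_sum hQ0, hs, hE1, hE2, hpow]
  rw [hE2] at hlow
  simp only [qPochs, List.map_cons, List.map_nil, List.prod_cons, List.prod_nil, mul_one,
    ← mul_assoc] at hab hlow ⊢
  rw [qPoch_mul_qPoch_neg, hs] at hlow
  have hqα := left_ne_zero_of_mul hlow
  have hEm := right_ne_zero_of_mul hlow
  have main := bailey_transform hQ hexy m hα1 hqα hαm
  rw [hEx, hEy] at main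
  have hα1' : 1 - α ≠ 0 := sub_ne_zero.2 hα1.symm
  trans qPoch q q m / (qPoch (α * a) q m * qPoch (α * b) q m) *
    (qPoch (α * q) q m * ∑ n ∈ Finset.range (m + 1), qPoch (q / a) q n * qPoch (q / b) q n *
        (α * e) ^ n * (qPoch (α * e) q (m - n) / qPoch q q (m - n)) *
        (1 / (qPoch q q n * qPoch (q * α) (q ^ 2) n)))
  · rw [Finset.mul_sum, Finset.mul_sum, Finset.mul_sum]
    refine Finset.sum_congr rfl fun n hn => ?_
    have h := qPoch_reverse_ratio hQ0 hQ hE0 (Nat.lt_succ_iff.1 (Finset.mem_range.1 hn)) hEm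
    linear_combination qPoch (α * q) q m / (qPoch (α * a) q m * qPoch (α * b) q m) *
      (qPoch (q / a) q n * qPoch (q / b) q n / (qPoch q q n * qPoch (q * α) (q ^ 2) n)) * h
  · rw [main, Finset.mul_sum]
    refine Finset.sum_congr rfl fun r hr => ?_
    have hr := Finset.mem_range.1 hr
    have hrm : 2 * r ≤ m := by omega
    have hA := qPoch_add (α * a) q (2 * r) (m - 2 * r)
    have hB := qPoch_add (α * b) q (2 * r) (m - 2 * r)
    have hR := qPoch_add q q (m - 2 * r) (2 * r)
    rw [Nat.add_sub_cancel' hrm] at hA hB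
    rw [Nat.sub_add_cancel hrm] at hR
    rw [hA, hB] at hab
    obtain ⟨⟨h1, h2⟩, h3, h4⟩ := by simpa only [mul_ne_zero_iff] using hab
    have hD := qPoch_ne_zero_of_le (show 2 * r ≤ 2 * (m / 2) by omega) hαm
    have hqr := qPoch_ne_zero_of_le (show r ≤ m by omega) hqα
    have hq2 := hQ (2 * r)
    rw [qPoch_two_mul, ← pow_two] at hq2
    have hq3 := left_ne_zero_of_mul hq2
    have hq4 := right_ne_zero_of_mul hq2
    have hq5 := hQ (m - 2 * r)
    have key := power_factor_identity hQ0 α (α * e) m r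
    -- Splitting (α;q)_{2r} and (q;q)_{2r} by parity cancels (qα;q²)_r and (q;q²)_r, leaving the
    -- ratio in `baileyCoeff`.
    rw [hqm, qPoch_reverse hQ0 hQ0 hrm, prod_range_pow_div q hQ0, baileyCoeff, hA, hB, hR,
      qPoch_two_mul α, qPoch_two_mul q, ← pow_two q, mul_comm α q]
    generalize (-1 / q) ^ (2 * r) * (q ^ (2 * r ^ 2 + r) / q ^ (2 * m * r)) = w at *
    generalize (-(α * (α * e) ^ 2 * (q ^ m) ^ 2)) ^ r = t at *
    generalize q ^ (r ^ 2) = z at *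
    generalize (-α) ^ r = c₁ at *
    generalize q ^ (3 * r ^ 2 - r) = c₂ at *
    generalize (α * e) ^ (2 * r) = c₃ at *
    generalize qPoch (α * a * q ^ (2 * r)) q (m - 2 * r) = p₁ at *
    generalize qPoch (α * b * q ^ (2 * r)) q (m - 2 * r) = p₂ at *
    generalize qPoch (α * q ^ (m + 1)) q (2 * r) = p₃ at *
    generalize qPoch (α * a) q (2 * r) = p₄ at *
    generalize qPoch (α * b) q (2 * r) = p₅ at *
    generalize qPoch (q * α) (q ^ 2) r = p₆ at *
    generalize 1 - α * q ^ (4 * r) = p₇ at *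
    generalize 1 - α = p₈ at *
    generalize qPoch (q * q ^ (m - 2 * r)) q (2 * r) = p₉ at *
    field_simp
    linear_combination -(p₉ * p₇ * qPoch α (q ^ 2) r * qPoch (q / a) q (2 * r) *
      qPoch (q / b) q (2 * r)) * key
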